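/- **Koch type sets.** For a segment in the Euclidean plane, a triangular cap on it with base angle $\theta\in[0,\pi/2)$ is the closed solid isosceles triangle having the segment as base and base angles $\theta$ (a degenerate triangle if $\theta=0$); its height is $\frac12\tan\theta$ times the length of the base. Let $A_{0,1}=[p,q]\subset\mathbb R^2$ with $p\ne q$, and let $T_{0,1}$ be a triangular cap on it with base angle $\theta_{0,1}$ and height less than $\frac1{100}|p-q|$. Given the $2^n$ caps $T_{n,i}$, $1\le i\le 2^n$, of generation $n$ with bases $A_{n,i}$ and base angles $\theta_{n,i}$, call the two shorter sides of $T_{n,i}$, in order from $p$ to $q$, $A_{n+1,2i-1}$ and $A_{n+1,2i}$, and build on each of them, inside $T_{n,i}$, a cap $T_{n+1,2i-1}$, $T_{n+1,2i}$ with base angle $\theta_{n+1,2i-1},\theta_{n+1,2i}\le\theta_{n,i}$. Let $B=\bigcap_{n\ge0}\bigcup_{i=1}^{2^n}T_{n,i}$ and let $E$ be the set of all vertices of all caps $T_{n,i}$, $n\ge 1$. A Koch type set is a set $A\in\{B,\,B\setminus E\}$ arising in this way. Write $A_0=[p,q]$. For $x=p+t(q-p)\in A_0$ let $i(n,x)\in\{1,\dots,2^n\}$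 be the index of the dyadic interval $[(i-1)2^{-n},i2^{-n}]$ that contains $t$ (a common end point of two intervals is counted as the left end point of the right one), and put $\tilde\theta_x=\lim_{n\to\infty}\theta_{n,i(n,x)}$. Let $F_n:A_0\to\mathbb R^2$ map, for each $i$, the $i$-th dyadic subinterval of $A_0$ of order $n$ affinely onto $A_{n,i}$ (preserving the order from $p$ to $q$), and let $\mathcal F=\lim_{n\to\infty}F_n$ pointwise. Let $$\gamma_1=\sup\{a:\mathcal H^1(\{x\in A_0:\tilde\theta_x\ge a\})>0\},\qquad \gamma_2=\sup_{x\in A_0}\tilde\theta_x,\qquad \Upsilon_{a+}=\mathcal F(\{x\in A_0:\tilde\theta_x\ge a\}),$$ $$f(\gamma)=\tfrac12\tan\gamma,\qquad f_1(\gamma)=-\frac{\ln 2}{\ln\left(\frac12(1+\tan^2\gamma)^{1/2}\right)}.$$ For $\varepsilon\ge0$ let $\Gamma_\varepsilon$ be the set $B$ of the above construction with base from $(0,0)$ to $(1,0)$ when every cap has height equal to $\varepsilon$ times the length of its base. **Theorem.** For every Koch type set $A$, with $\dim$ the Hausdorff dimension, $$\dim\Gamma_{f(\gamma_1)}=f_1(\gamma_1)\le\dim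 A\le f_1(\gamma_2)=\dim\Gamma_{f(\gamma_2)}.$$ If moreover $\mathcal H^1(S)=0$ implies $\mathcal H^1(\mathcal F(S))=0$ for all $S\subset A_0$, or if $\mathcal H^1(\Upsilon_{\gamma_1+})=0$, then $\dim A=f_1(\gamma_1)$. -/

import Mathlib

open Set Filter Topology MeasureTheory

/-- The apex of the triangular cap of relative height `h` (height divided by base length) on the
segment from `s.1` to `s.2` in the Euclidean plane `ℂ`; `Complex.I * (s.2 - s.1)` is the base
vector turned left by a right angle, so for `h > 0` the apex is to the left of the base. -/
noncomputable def capApex (h : ℝ) (s : ℂ × ℂ) : ℂ :=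
  (s.1 + s.2) / 2 + (h : ℂ) * (Complex.I * (s.2 - s.1))

/-- The (solid, closed) triangular cap of relative height `h` on a segment. -/
noncomputable def triCap (h : ℝ) (s : ℂ × ℂ) : Set ℂ :=
  convexHull ℝ {s.1, s.2, capApex h s}

/-- The data of the cap construction: the end points of the initial base, and the relative height
`h n i ≥ 0` of the `i`-th cap of generation `n`, where `0 ≤ i < 2 ^ n`, counted from left to right
(the other values of `h` are never used). -/
structure CapData where
  p : ℂ
  q : ℂ
  h : ℕ → ℕ → ℝ

namespace CapData

/-- The signed relative height of the `i`-th cap of generation `n`. The first cap is to the left of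
its base; seen from a shorter side of a cap (directed like the base), that cap lies on the other
side, so the new caps, which are built into the old one, change sides at each generation. -/
noncomputable def height (D : CapData) (n i : ℕ) : ℝ := (-1) ^ n * D.h n i

/-- The directed base `A_{n,i}` of the `i`-th cap of generation `n`: the given base for `n = 0`;
cap `i` of generation `n` has as its two shorter sides the bases `2 i` and `2 i + 1` of
generation `n + 1`. -/
noncomputable def side (D : CapData) : ℕ → ℕ → ℂ × ℂ
  | 0, _ => (D.p, D.q)
  | n + 1, i =>
    if i % 2 = 0 then ((side D n (i / 2)).1, capApex (D.height n (i / 2)) (side D n (i / 2)))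
    else (capApex (D.height n (i / 2)) (side D n (i / 2)), (side D n (i / 2)).2)

/-- The triangular cap `T_{n,i}`. -/
noncomputable def cap (D : CapData) (n i : ℕ) : Set ℂ := triCap (D.height n i) (D.side n i)

/-- The `n`-th approximation `A_n`, the union of the `2 ^ n` caps of generation `n`. -/
noncomputable def approx (D : CapData) (n : ℕ) : Set ℂ := ⋃ i ∈ Finset.range (2 ^ n), D.cap n i

/-- The limit set of the construction, the intersection of all approximations. -/
noncomputable def limitSet (D : CapData) : Set ℂ := ⋂ n, D.approx n

/-- The edge points: all vertices of the caps of generation `n ≥ 1` (the vertices of the first cap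
are among them). -/
noncomputable def edgePoints (D : CapData) : Set ℂ :=
  ⋃ n ∈ Ici 1, ⋃ i ∈ Finset.range (2 ^ n),
    {(D.side n i).1, (D.side n i).2, capApex (D.height n i) (D.side n i)}

/-- The point of the initial base with parameter `t ∈ [0,1]`. -/
noncomputable def basePoint (D : CapData) (t : ℝ) : ℂ := AffineMap.lineMap D.p D.q t

end CapData

/-- The index (from `0` to `2 ^ n - 1`) of the dyadic interval of order `n` containing `t ∈ [0,1]`.
A common end point of two dyadic intervals is counted as the left end point of the right one. -/
noncomputable def dyadicIndex (n : ℕ) (t : ℝ) : ℕ := min ⌊2 ^ n * t⌋₊ (2 ^ n - 1)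

namespace CapData

/-- The `n`-th polygonal parametrisation: it maps the `i`-th dyadic subinterval of `[0,1]` of order
`n` affinely onto the segment `A_{n,i}`. -/
noncomputable def polygon (D : CapData) (n : ℕ) (t : ℝ) : ℂ :=
  AffineMap.lineMap (D.side n (dyadicIndex n t)).1 (D.side n (dyadicIndex n t)).2
    (2 ^ n * t - (dyadicIndex n t : ℝ))

/-- The limit parametrisation `ℱ` as a function of the parameter `t ∈ [0,1]` of the base point. -/
noncomputable def limitMap (D : CapData) (t : ℝ) : ℂ :=
  limUnder atTop (fun n : ℕ => D.polygon n t)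

end CapData

/-- The set `Γ_ε`: base from `0` to `1`, all caps with relative height `ε`. -/
noncomputable def GammaSet (ε : ℝ) : Set ℂ :=
  CapData.limitSet { p := 0, q := 1, h := fun _ _ => ε }

/-- The data of a Koch type set: a base of positive length, with end points `p` and `q`, and base
angles `θ n i` of the `i`-th cap of generation `n`, `0 ≤ i < 2 ^ n`, that do not increase from a cap
to the two caps built on its shorter sides, the first cap having height less than `1/100` times the
length of its base. -/
structure KochConstruction where
  p : ℂ
  q : ℂ
  p_ne_q : p ≠ q
  θ : ℕ → ℕ → ℝ
  θ_nonneg : ∀ n i, i < 2 ^ n → 0 ≤ θ n i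
  θ_zero_lt : θ 0 0 < Real.pi / 2
  θ_zero_flat : Real.tan (θ 0 0) / 2 < 1 / 100
  θ_left_le : ∀ n i, i < 2 ^ n → θ (n + 1) (2 * i) ≤ θ n i
  θ_right_le : ∀ n i, i < 2 ^ n → θ (n + 1) (2 * i + 1) ≤ θ n i

namespace KochConstruction

/-- The cap construction: an isosceles triangle with base angle `θ` has relative height
`tan θ / 2`. -/
noncomputable def toCapData (K : KochConstruction) : CapData where
  p := K.p
  q := K.q
  h := fun n i => Real.tan (K.θ n i) / 2

/-- `A` is one of the two Koch type sets given by the construction: the limit set, or the limit set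
without the edge points. -/
def IsKochTypeSet (K : KochConstruction) (A : Set ℂ) : Prop :=
  A = K.toCapData.limitSet ∨ A = K.toCapData.limitSet \ K.toCapData.edgePoints

/-- The limiting base angle at the base point with parameter `t ∈ [0,1]`. -/
noncomputable def limitAngle (K : KochConstruction) (t : ℝ) : ℝ :=
  limUnder atTop (fun n : ℕ => K.θ n (dyadicIndex n t))

/-- The parameters of the base points whose limiting base angle is at least `a`. -/
def angleGe (K : KochConstruction) (a : ℝ) : Set ℝ := {t ∈ Icc (0 : ℝ) 1 | a ≤ K.limitAngle t}

/-- `γ₁`, the essential supremum of the limiting base angle with respect to the one-dimensional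
Hausdorff measure on the base. -/
noncomputable def gamma₁ (K : KochConstruction) : ℝ :=
  sSup {a : ℝ | 0 < μH[1] (K.toCapData.basePoint '' K.angleGe a)}

/-- `γ₂`, the supremum of the limiting base angle over the base. -/
noncomputable def gamma₂ (K : KochConstruction) : ℝ := sSup (K.limitAngle '' Icc (0 : ℝ) 1)

/-- Subsets of the base of zero length have images of zero length under `ℱ`. -/
def NullToNull (K : KochConstruction) : Prop :=
  ∀ S : Set ℝ, S ⊆ Icc 0 1 → μH[1] (K.toCapData.basePoint '' S) = 0 →
    μH[1] (K.toCapData.limitMap '' S) = 0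

end KochConstruction

/-- `f(γ) = (1/2) tan γ`. -/
noncomputable def kochF (γ : ℝ) : ℝ := 1 / 2 * Real.tan γ

/-- `f₁(γ) = - ln 2 / ln ((1/2) (1 + tan² γ)^{1/2})`. -/
noncomputable def kochF₁ (γ : ℝ) : ℝ :=
  -(Real.log 2 / Real.log (1 / 2 * Real.sqrt (1 + Real.tan γ ^ 2)))

/-!
Every cap lies in its parent and the bases shrink geometrically, so a parameter `t ∈ [0,1]`
determines a nested sequence of caps whose intersection is the point `ℱ(t)`. The limit set is the
image of `ℱ` up to countably many points (`KochConstruction.limitSet_subset`), and the edge points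
are countable too, so all dimensions can be computed for images `ℱ(S)`. If `r` is the ratio
`½ (1 + tan² γ)^{1/2}` of a shorter side to the base, then `f₁(γ)` is the exponent `d` with
`r ^ d = 1 / 2`, which turns the scale `r ^ n` of the caps into the scale `2⁻ⁿ` of the parameters.

*Upper bounds.* Where the limiting angle is at most `γ`, the angles are eventually below any larger
`c`, and the `2 ^ n` caps of generation `n` have diameter `O(r(c) ^ n)`; covering by them gives
dimension at most `f₁(c)` (`KochConstruction.dimH_limitMap_le`), and `c → γ`. For `γ = γ₂` this
covers all parameters. For `γ = γ₁` it leaves out a set of parameters of length zero; if its image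
has length zero as well, it contributes dimension at most `1 ≤ f₁(γ₁)`.

*Lower bound.* On the set `S` of parameters with limiting angle at least `a` all bases of generation
`n` have length at least `c * r(a) ^ n`. The flatness of the first cap enters here: two parameters
are first separated at a dyadic midpoint, whose image is the apex of a cap, and the two parts of the
limit set on either side of it are seen from the apex at an obtuse angle
(`re_conj_mul_nonpos`). Hence the images are at least as far apart as either of them is from the
apex, and that distance is comparable to the length of a base at the scale of the parameters
(`KochConstruction.exists_half_len_le_dist`). So the inverse of `ℱ` is Hölder continuous on `ℱ(S)`
with exponent `f₁(a)`, and `dim ℱ(S) ≥ f₁(a)` as soon as `S` has positive length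
(`KochConstruction.le_dimH_limitMap`); let `a` increase to `γ₁`.

The sets `Γ` are the case of constant angles, where `γ₁ = γ₂`.
-/

/-! ### The geometry of a single cap -/

theorem capApex_eq (h : ℝ) (s : ℂ × ℂ) :
    capApex h s = s.1 + (1 / 2 + h * Complex.I) * (s.2 - s.1) := by
  unfold capApex; ring

theorem fst_mem_triCap (h : ℝ) (s : ℂ × ℂ) : s.1 ∈ triCap h s :=
  subset_convexHull ℝ _ (by simp)

theorem snd_mem_triCap (h : ℝ) (s : ℂ × ℂ) : s.2 ∈ triCap h s :=
  subset_convexHull ℝ _ (by simp)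

theorem capApex_mem_triCap (h : ℝ) (s : ℂ × ℂ) : capApex h s ∈ triCap h s :=
  subset_convexHull ℝ _ (by simp)

theorem convex_triCap (h : ℝ) (s : ℂ × ℂ) : Convex ℝ (triCap h s) := convex_convexHull ℝ _

theorem isClosed_triCap (h : ℝ) (s : ℂ × ℂ) : IsClosed (triCap h s) :=
  (Set.Finite.isCompact_convexHull (𝕜 := ℝ) (by simp)).isClosed

theorem barycentric_mem_triCap {h α β : ℝ} (s : ℂ × ℂ) {z : ℂ} (hα : 0 ≤ α) (hβ : 0 ≤ β)
    (hαβ : α + β ≤ 1) (hz : z = s.1 + α * (s.2 - s.1) + β * (capApex h s - s.1)) :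
    z ∈ triCap h s := by
  have := (convex_triCap h s).sum_mem (t := Finset.univ) (w := ![1 - α - β, α, β])
    (z := ![s.1, s.2, capApex h s]) (by intro i _; fin_cases i <;> simp <;> linarith)
    (by simp [Fin.sum_univ_three]; ring)
    (by
      intro i _
      fin_cases i
      exacts [fst_mem_triCap h s, snd_mem_triCap h s, capApex_mem_triCap h s])
  convert this using 1
  rw [hz]
  simp [Fin.sum_univ_three]
  ring

theorem triCap_subset_of_vertices {h h' : ℝ} {s s' : ℂ × ℂ} (h₁ : s'.1 ∈ triCap h s)
    (h₂ : s'.2 ∈ triCap h s) (h₃ : capApex h' s' ∈ triCap h s) : triCap h' s' ⊆ triCap h s := by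
  refine convexHull_min ?_ (convex_triCap h s)
  rintro z (rfl | rfl | rfl) <;> assumption

/-- A cap built on the left shorter side, on the inner side and with a base angle that is not
larger, stays inside the cap. The signed heights are `H` and `-k * H` with `0 ≤ k ≤ 1`. -/
theorem triCap_left_subset {H k : ℝ} (s : ℂ × ℂ) (hH : H ^ 2 ≤ 1 / 4) (h0 : 0 ≤ k) (h1 : k ≤ 1) :
    triCap (-k * H) (s.1, capApex H s) ⊆ triCap H s := by
  refine triCap_subset_of_vertices (fst_mem_triCap H s) (capApex_mem_triCap H s)
    (barycentric_mem_triCap (α := k * H ^ 2 + k / 4) (β := (1 - k) / 2) s (by positivity)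
      (by linarith) (by nlinarith) ?_)
  simp only [capApex_eq]
  push_cast
  linear_combination (-(k : ℂ) * H ^ 2 * (s.2 - s.1)) * Complex.I_sq

/-- The mirror image of `triCap_left_subset`. -/
theorem triCap_right_subset {H k : ℝ} (s : ℂ × ℂ) (hH : H ^ 2 ≤ 1 / 4) (h0 : 0 ≤ k)
    (h1 : k ≤ 1) : triCap (-k * H) (capApex H s, s.2) ⊆ triCap H s := by
  refine triCap_subset_of_vertices (capApex_mem_triCap H s) (snd_mem_triCap H s)
    (barycentric_mem_triCap (α := 1 / 2 + k / 4 - k * H ^ 2) (β := (1 - k) / 2) s (by nlinarith)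
      (by linarith) (by nlinarith [sq_nonneg H]) ?_)
  simp only [capApex_eq]
  push_cast
  linear_combination ((k : ℂ) * H ^ 2 * (s.2 - s.1)) * Complex.I_sq

theorem norm_half_add_mul_I (H : ℝ) : ‖(1 / 2 + H * Complex.I : ℂ)‖ = √(1 / 4 + H ^ 2) := by
  have := Complex.norm_add_mul_I (1 / 2) H
  push_cast at this
  rw [this]
  norm_num

theorem dist_fst_capApex (H : ℝ) (s : ℂ × ℂ) :
    dist s.1 (capApex H s) = √(1 / 4 + H ^ 2) * dist s.1 s.2 := by
  rw [dist_comm, dist_comm s.1 s.2, dist_eq_norm, dist_eq_norm, capApex_eq, add_sub_cancel_left,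
    norm_mul, norm_half_add_mul_I]

theorem dist_capApex_snd (H : ℝ) (s : ℂ × ℂ) :
    dist (capApex H s) s.2 = √(1 / 4 + H ^ 2) * dist s.1 s.2 := by
  have h : s.2 - capApex H s = (1 / 2 + (-H : ℝ) * Complex.I) * (s.2 - s.1) := by
    rw [capApex_eq]; push_cast; ring
  rw [dist_comm, dist_comm s.1 s.2, dist_eq_norm, dist_eq_norm, h, norm_mul, norm_half_add_mul_I,
    neg_sq]

theorem ediam_triCap_le {H : ℝ} (s : ℂ × ℂ) (hH : H ^ 2 ≤ 1 / 4) :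
    Metric.ediam (triCap H s) ≤ ENNReal.ofReal (dist s.1 s.2) := by
  have hr : √(1 / 4 + H ^ 2) ≤ 1 := by
    rw [Real.sqrt_le_iff]; constructor <;> linarith
  have hm : √(1 / 4 + H ^ 2) * dist s.1 s.2 ≤ dist s.1 s.2 :=
    mul_le_of_le_one_left dist_nonneg hr
  have h₁ := dist_fst_capApex H s
  have h₂ := dist_capApex_snd H s
  rw [triCap, convexHull_ediam]
  refine Metric.ediam_le fun x hx y hy => ?_
  rw [edist_dist]
  refine ENNReal.ofReal_le_ofReal ?_
  rcases hx with rfl | rfl | rfl <;> rcases hy with rfl | rfl | rfl <;>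
    simp only [dist_self, dist_nonneg, dist_comm s.2, dist_comm _ s.1, le_refl, h₁, h₂, hm]

theorem dist_le_of_mem_triCap {H : ℝ} {s : ℂ × ℂ} (hH : H ^ 2 ≤ 1 / 4) {x y : ℂ}
    (hx : x ∈ triCap H s) (hy : y ∈ triCap H s) : dist x y ≤ dist s.1 s.2 := by
  have := (Metric.edist_le_ediam_of_mem hx hy).trans (ediam_triCap_le s hH)
  rwa [edist_dist, ENNReal.ofReal_le_ofReal_iff dist_nonneg] at this

/-- A closed half plane that contains the vertices of a cap contains the cap. -/
theorem re_mul_le_of_mem_triCap {H d : ℝ} {s : ℂ × ℂ} (c : ℂ) (h₁ : (c * s.1).re ≤ d)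
    (h₂ : (c * s.2).re ≤ d) (h₃ : (c * capApex H s).re ≤ d) {z : ℂ} (hz : z ∈ triCap H s) :
    (c * z).re ≤ d := by
  have hc : Convex ℝ {w : ℂ | (c * w).re ≤ d} :=
    convex_halfSpace_le (f := fun w : ℂ => (c * w).re)
      ⟨fun x y => by simp [mul_add], fun a x => by simp; ring⟩ d
  refine convexHull_min ?_ hc hz
  rintro w (rfl | rfl | rfl) <;> assumption

/-- The right half of a cap is at a distance of at least half the base from the left end. -/
theorem half_le_dist_fst {H H' : ℝ} {s : ℂ × ℂ} (hH : |H| ≤ 1 / 100) (hH' : |H'| ≤ 1 / 100) {z : ℂ}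
    (hz : z ∈ triCap H' (capApex H s, s.2)) : dist s.1 s.2 / 2 ≤ dist z s.1 := by
  set e := s.2 - s.1 with he
  have hs2 : s.2 = s.1 + e := by rw [he]; ring
  obtain ⟨a, b⟩ := abs_le.1 hH
  obtain ⟨a', b'⟩ := abs_le.1 hH'
  have hN : 0 ≤ e.re ^ 2 + e.im ^ 2 := by positivity
  -- The projection of `z - s.1` to the base has at least half the length of the base.
  have key : ((-(starRingEnd ℂ) e) * z).re ≤
      ((-(starRingEnd ℂ) e) * s.1).re - (e.re ^ 2 + e.im ^ 2) / 2 := by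
    refine re_mul_le_of_mem_triCap _ ?_ ?_ ?_ hz <;>
      simp only [capApex_eq, hs2, add_sub_cancel_left] <;> simp
    · nlinarith
    · nlinarith
    · have : 0 ≤ (1 / 4 + H * H') * (e.re ^ 2 + e.im ^ 2) :=
        mul_nonneg (by nlinarith) hN
      nlinarith
  have h1 : ‖e‖ ^ 2 / 2 ≤ ‖e‖ * ‖z - s.1‖ := by
    have h2 := Complex.re_le_norm ((starRingEnd ℂ) e * (z - s.1))
    rw [norm_mul, Complex.norm_conj] at h2
    refine le_trans ?_ h2
    rw [Complex.sq_norm, Complex.normSq_apply]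
    simp at key ⊢
    linarith
  rw [dist_comm s.1, dist_eq_norm, dist_eq_norm, ← he]
  rcases (norm_nonneg e).eq_or_lt with h0 | h0
  · rw [← h0]; simp
  · refine le_of_mul_le_mul_left ?_ h0
    linarith

/-- The left half of a cap is at a distance of at least half the base from the right end. -/
theorem half_le_dist_snd {H H' : ℝ} {s : ℂ × ℂ} (hH : |H| ≤ 1 / 100) (hH' : |H'| ≤ 1 / 100) {z : ℂ}
    (hz : z ∈ triCap H' (s.1, capApex H s)) : dist s.1 s.2 / 2 ≤ dist z s.2 := by
  -- Reversing the direction of the base and the sign of the height yields the same triangle.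
  have hswap : ∀ (h : ℝ) (a b : ℂ), capApex h (b, a) = capApex (-h) (a, b) := by
    intro h a b; simp only [capApex]; push_cast; ring
  have hz' : z ∈ triCap (-H') (capApex (-H) (s.2, s.1), (s.2, s.1).2) := by
    have h1 : capApex (-H) (s.2, s.1) = capApex H s := by rw [hswap, neg_neg]
    have h2 : capApex (-H') (capApex H s, s.1) = capApex H' (s.1, capApex H s) := by
      rw [hswap, neg_neg]
    rw [triCap, h1, h2, Set.insert_comm]
    exact hz
  have := half_le_dist_fst (by rwa [abs_neg]) (by rwa [abs_neg]) hz'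
  rwa [dist_comm s.2 s.1] at this

/-- The caps on the two shorter sides of a flat cap are seen from the apex at an obtuse angle. -/
theorem re_conj_mul_nonpos {H H₁ H₂ : ℝ} {s : ℂ × ℂ} (hH : |H| ≤ 1 / 100) (hH₁ : |H₁| ≤ 1 / 100)
    (hH₂ : |H₂| ≤ 1 / 100) {u w : ℂ} (hu : u ∈ triCap H₁ (s.1, capApex H s))
    (hw : w ∈ triCap H₂ (capApex H s, s.2)) :
    ((starRingEnd ℂ) (u - capApex H s) * (w - capApex H s)).re ≤ 0 := by
  set e := s.2 - s.1 with he
  obtain ⟨a, b⟩ := abs_le.1 hH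
  obtain ⟨a₁, b₁⟩ := abs_le.1 hH₁
  obtain ⟨a₂, b₂⟩ := abs_le.1 hH₂
  have hN : 0 ≤ e.re ^ 2 + e.im ^ 2 := by positivity
  have q0 : 0 ≤ H ^ 2 := sq_nonneg H
  have q1 : H ^ 2 ≤ 1 / 10000 := by nlinarith
  have p1 : |H * H₁| ≤ 1 / 10000 := by
    rw [abs_mul]; nlinarith [abs_nonneg H, abs_nonneg H₁]
  have p2 : |H * H₂| ≤ 1 / 10000 := by
    rw [abs_mul]; nlinarith [abs_nonneg H, abs_nonneg H₂]
  have p3 : |H₁ * H₂| ≤ 1 / 10000 := by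
    rw [abs_mul]; nlinarith [abs_nonneg H₁, abs_nonneg H₂]
  rw [abs_le] at p1 p2 p3
  have k1 : 0 ≤ (1 / 4 - H ^ 2) * (e.re ^ 2 + e.im ^ 2) := mul_nonneg (by linarith) hN
  have k2 : 0 ≤ ((1 / 4 - H ^ 2) / 2 + H * H₂) * (e.re ^ 2 + e.im ^ 2) :=
    mul_nonneg (by linarith) hN
  have k3 : 0 ≤ ((1 / 4 - H ^ 2) / 2 + H * H₁) * (e.re ^ 2 + e.im ^ 2) :=
    mul_nonneg (by linarith) hN
  have k4 : 0 ≤ ((1 / 4 - H ^ 2) * (1 / 4 - H₁ * H₂) + (H * H₁ + H * H₂) / 2) *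
      (e.re ^ 2 + e.im ^ 2) := mul_nonneg (by nlinarith) hN
  have e1 : s.1 - capApex H s = -(1 / 2 + H * Complex.I) * e := by rw [capApex_eq, he]; ring
  have e2 : s.2 - capApex H s = (1 / 2 - H * Complex.I) * e := by rw [capApex_eq, he]; ring
  have e3 : capApex H₁ (s.1, capApex H s) - capApex H s =
      -(1 / 2 + H * Complex.I) * (1 / 2 - H₁ * Complex.I) * e := by
    rw [capApex_eq H₁]; linear_combination (1 / 2 - H₁ * Complex.I) * e1
  have e4 : capApex H₂ (capApex H s, s.2) - capApex H s =
      (1 / 2 + H₂ * Complex.I) * (1 / 2 - H * Complex.I) * e := by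
    rw [capApex_eq H₂]; linear_combination (1 / 2 + H₂ * Complex.I) * e2
  -- The inner product is affine in each variable, so only the vertices matter.
  have step : ∀ c : ℂ, (c * (s.2 - capApex H s)).re ≤ 0 →
      (c * (capApex H₂ (capApex H s, s.2) - capApex H s)).re ≤ 0 →
      (c * (w - capApex H s)).re ≤ 0 := by
    intro c h₂ h₃
    have := re_mul_le_of_mem_triCap (d := (c * capApex H s).re) c le_rfl
      (by rw [mul_sub, Complex.sub_re] at h₂; linarith)
      (by rw [mul_sub, Complex.sub_re] at h₃; linarith) hw
    rw [mul_sub, Complex.sub_re]; linarith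
  have step' : ∀ c : ℂ, (c * (s.1 - capApex H s)).re ≤ 0 →
      (c * (capApex H₁ (s.1, capApex H s) - capApex H s)).re ≤ 0 →
      (c * (u - capApex H s)).re ≤ 0 := by
    intro c h₂ h₃
    have := re_mul_le_of_mem_triCap (d := (c * capApex H s).re) c
      (by rw [mul_sub, Complex.sub_re] at h₂; linarith) le_rfl
      (by rw [mul_sub, Complex.sub_re] at h₃; linarith) hu
    rw [mul_sub, Complex.sub_re]; linarith
  have hconj : ∀ x y : ℂ, ((starRingEnd ℂ) x * y).re = ((starRingEnd ℂ) y * x).re := by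
    intro x y; simp; ring
  apply step <;> rw [hconj] <;> apply step' <;> simp only [e1, e2, e3, e4] <;> simp <;> linarith

theorem dist_apex_le_dist {H H₁ H₂ : ℝ} {s : ℂ × ℂ} (hH : |H| ≤ 1 / 100) (hH₁ : |H₁| ≤ 1 / 100)
    (hH₂ : |H₂| ≤ 1 / 100) {u w : ℂ} (hu : u ∈ triCap H₁ (s.1, capApex H s))
    (hw : w ∈ triCap H₂ (capApex H s, s.2)) :
    dist u (capApex H s) ≤ dist u w ∧ dist w (capApex H s) ≤ dist u w := by
  have key := re_conj_mul_nonpos hH hH₁ hH₂ hu hw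
  set v := capApex H s
  have h : ‖u - w‖ ^ 2 = ‖u - v‖ ^ 2 + ‖w - v‖ ^ 2 -
      2 * ((starRingEnd ℂ) (u - v) * (w - v)).re := by
    simp only [Complex.sq_norm, Complex.normSq_apply]
    simp
    ring
  simp only [dist_eq_norm]
  constructor <;> refine (sq_le_sq₀ (norm_nonneg _) (norm_nonneg _)).1 ?_
  · nlinarith [sq_nonneg ‖w - v‖]
  · nlinarith [sq_nonneg ‖u - v‖]

/-! ### Dyadic indices -/

theorem dyadicIndex_lt (n : ℕ) (t : ℝ) : dyadicIndex n t < 2 ^ n :=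
  (min_le_right _ _).trans_lt (Nat.sub_lt (by positivity) one_pos)

theorem dyadicIndex_div_two (n : ℕ) (t : ℝ) : dyadicIndex (n + 1) t / 2 = dyadicIndex n t := by
  have h : ⌊2 ^ (n + 1) * t⌋₊ / 2 = ⌊2 ^ n * t⌋₊ := by
    rw [← Nat.floor_div_natCast]
    congr 1
    push_cast
    ring
  have h2 : 1 ≤ 2 ^ n := Nat.one_le_two_pow
  unfold dyadicIndex
  rw [pow_succ] at *
  omega

theorem dyadicIndex_succ (n : ℕ) (t : ℝ) :
    dyadicIndex (n + 1) t = 2 * dyadicIndex n t ∨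
      dyadicIndex (n + 1) t = 2 * dyadicIndex n t + 1 := by
  have := dyadicIndex_div_two n t
  omega

theorem dyadicIndex_mono (n : ℕ) : Monotone (dyadicIndex n) := fun s t hst =>
  min_le_min_right _ (Nat.floor_le_floor (by gcongr))

theorem dyadicIndex_le {t : ℝ} (ht : 0 ≤ t) (n : ℕ) : (dyadicIndex n t : ℝ) ≤ 2 ^ n * t :=
  (Nat.cast_le.2 (min_le_left _ _)).trans (Nat.floor_le (by positivity))

theorem le_dyadicIndex_add_one {t : ℝ} (ht : t ≤ 1) (n : ℕ) :
    2 ^ n * t ≤ (dyadicIndex n t : ℝ) + 1 := by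
  unfold dyadicIndex
  rcases min_cases ⌊2 ^ n * t⌋₊ (2 ^ n - 1) with ⟨h, -⟩ | ⟨h, -⟩ <;> rw [h]
  · exact (Nat.lt_floor_add_one _).le
  · rw [Nat.cast_sub Nat.one_le_two_pow]
    push_cast
    have : (0 : ℝ) < 2 ^ n := by positivity
    nlinarith

theorem dyadicIndex_eq {n i : ℕ} {t : ℝ} (hi : i < 2 ^ n) (h₁ : (i : ℝ) ≤ 2 ^ n * t)
    (h₂ : 2 ^ n * t < i + 1) : dyadicIndex n t = i := by
  have : ⌊2 ^ n * t⌋₊ = i := by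
    rw [Nat.floor_eq_iff (le_trans (Nat.cast_nonneg i) h₁)]
    exact ⟨h₁, h₂⟩
  unfold dyadicIndex
  omega

/-- The length of a shorter side of a cap with base angle `γ`, relative to its base. -/
noncomputable def sideRatio (γ : ℝ) : ℝ := 1 / 2 * √(1 + Real.tan γ ^ 2)

theorem half_le_sideRatio (γ : ℝ) : 1 / 2 ≤ sideRatio γ := by
  have : 1 ≤ √(1 + Real.tan γ ^ 2) := Real.one_le_sqrt.2 (by nlinarith [sq_nonneg (Real.tan γ)])
  unfold sideRatio
  linarith

theorem sideRatio_pos (γ : ℝ) : 0 < sideRatio γ := by linarith [half_le_sideRatio γ]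

namespace KochConstruction

variable (K : KochConstruction)

/-! ### Angles and heights of the caps -/

theorem θ_succ_le {n j : ℕ} (hj : j < 2 ^ (n + 1)) : K.θ (n + 1) j ≤ K.θ n (j / 2) := by
  have hj' : j / 2 < 2 ^ n := by rw [pow_succ] at hj; omega
  rcases Nat.even_or_odd' j with ⟨i, rfl | rfl⟩
  · have := K.θ_left_le n i (by omega)
    rwa [show 2 * i / 2 = i by omega]
  · have := K.θ_right_le n i (by omega)
    rwa [show (2 * i + 1) / 2 = i by omega]

theorem θ_le_θ_zero {n i : ℕ} (hi : i < 2 ^ n) : K.θ n i ≤ K.θ 0 0 := by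
  induction n generalizing i with
  | zero => rw [show i = 0 by simpa using hi]
  | succ n ih => exact (K.θ_succ_le hi).trans (ih (by rw [pow_succ] at hi; omega))

theorem tan_le_tan {a b : ℝ} (ha : 0 ≤ a) (hab : a ≤ b) (hb : b ≤ K.θ 0 0) :
    Real.tan a ≤ Real.tan b := by
  have := K.θ_zero_lt
  exact Real.strictMonoOn_tan.monotoneOn ⟨by linarith, by linarith⟩ ⟨by linarith, by linarith⟩ hab

theorem tan_nonneg {a : ℝ} (ha : 0 ≤ a) (hb : a ≤ K.θ 0 0) : 0 ≤ Real.tan a := by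
  simpa using K.tan_le_tan le_rfl ha hb

theorem sideRatio_le_sideRatio {a b : ℝ} (ha : 0 ≤ a) (hab : a ≤ b) (hb : b ≤ K.θ 0 0) :
    sideRatio a ≤ sideRatio b := by
  have h0 := K.tan_nonneg ha (hab.trans hb)
  have h1 := K.tan_le_tan ha hab hb
  unfold sideRatio
  gcongr

theorem sideRatio_le {a : ℝ} (ha : 0 ≤ a) (hb : a ≤ K.θ 0 0) : sideRatio a ≤ 3 / 5 := by
  have h0 := K.tan_nonneg ha hb
  have h1 := K.tan_le_tan ha hb le_rfl
  have h2 := K.θ_zero_flat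
  have : √(1 + Real.tan a ^ 2) ≤ 6 / 5 := by
    rw [Real.sqrt_le_iff]
    constructor <;> nlinarith
  unfold sideRatio
  linarith

theorem sideRatio_lt_one {a : ℝ} (ha : 0 ≤ a) (hb : a ≤ K.θ 0 0) : sideRatio a < 1 :=
  (K.sideRatio_le ha hb).trans_lt (by norm_num)

theorem h_nonneg {n i : ℕ} (hi : i < 2 ^ n) : 0 ≤ K.toCapData.h n i :=
  div_nonneg (K.tan_nonneg (K.θ_nonneg n i hi) (K.θ_le_θ_zero hi)) two_pos.le

theorem h_le {n i : ℕ} (hi : i < 2 ^ n) : K.toCapData.h n i ≤ 1 / 100 := by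
  have := K.tan_le_tan (K.θ_nonneg n i hi) (K.θ_le_θ_zero hi) le_rfl
  have := K.θ_zero_flat
  change Real.tan (K.θ n i) / 2 ≤ _
  linarith

theorem h_succ_le {n j : ℕ} (hj : j < 2 ^ (n + 1)) :
    K.toCapData.h (n + 1) j ≤ K.toCapData.h n (j / 2) := by
  have hj' : j / 2 < 2 ^ n := by rw [pow_succ] at hj; omega
  have := K.tan_le_tan (K.θ_nonneg _ _ hj) (K.θ_succ_le hj) (K.θ_le_θ_zero hj')
  change Real.tan (K.θ (n + 1) j) / 2 ≤ Real.tan (K.θ n (j / 2)) / 2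
  linarith

theorem abs_height_le {n i : ℕ} (hi : i < 2 ^ n) : |K.toCapData.height n i| ≤ 1 / 100 := by
  unfold CapData.height
  rw [abs_mul, abs_pow, abs_neg, abs_one, one_pow, one_mul, abs_of_nonneg (K.h_nonneg hi)]
  exact K.h_le hi

theorem height_sq_le {n i : ℕ} (hi : i < 2 ^ n) : K.toCapData.height n i ^ 2 ≤ 1 / 4 := by
  have := K.abs_height_le hi
  rw [← sq_abs]
  nlinarith [abs_nonneg (K.toCapData.height n i)]

theorem sqrt_height (n i : ℕ) :
    √(1 / 4 + K.toCapData.height n i ^ 2) = sideRatio (K.θ n i) := by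
  have h : K.toCapData.height n i ^ 2 = (Real.tan (K.θ n i) / 2) ^ 2 := by
    unfold CapData.height
    rw [mul_pow, ← pow_mul, mul_comm n 2, pow_mul]
    simp [toCapData]
  rw [h, sideRatio, show 1 / 4 + (Real.tan (K.θ n i) / 2) ^ 2 =
    (1 / 2) ^ 2 * (1 + Real.tan (K.θ n i) ^ 2) by ring, Real.sqrt_mul (by positivity),
    Real.sqrt_sq (by norm_num)]

theorem height_succ {n j : ℕ} (hj : j < 2 ^ (n + 1)) :
    ∃ k : ℝ, 0 ≤ k ∧ k ≤ 1 ∧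
      K.toCapData.height (n + 1) j = -k * K.toCapData.height n (j / 2) := by
  have hj' : j / 2 < 2 ^ n := by rw [pow_succ] at hj; omega
  have h0 := K.h_nonneg hj
  have h1 := K.h_nonneg hj'
  have h2 := K.h_succ_le hj
  refine ⟨K.toCapData.h (n + 1) j / K.toCapData.h n (j / 2), div_nonneg h0 h1,
    div_le_one_of_le₀ h2 h1, ?_⟩
  have h3 : K.toCapData.h (n + 1) j / K.toCapData.h n (j / 2) * K.toCapData.h n (j / 2) =
      K.toCapData.h (n + 1) j := div_mul_cancel_of_imp fun h => by linarith
  unfold CapData.height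
  rw [pow_succ]
  linear_combination ((-1 : ℝ) ^ n) * h3

/-! ### Nested caps -/

theorem _root_.CapData.side_left (D : CapData) (n i : ℕ) :
    D.side (n + 1) (2 * i) = ((D.side n i).1, capApex (D.height n i) (D.side n i)) := by
  rw [CapData.side, if_pos (by omega), show 2 * i / 2 = i by omega]

theorem _root_.CapData.side_right (D : CapData) (n i : ℕ) :
    D.side (n + 1) (2 * i + 1) = (capApex (D.height n i) (D.side n i), (D.side n i).2) := by
  rw [CapData.side, if_neg (by omega), show (2 * i + 1) / 2 = i by omega]

theorem cap_succ_subset {n j : ℕ} (hj : j < 2 ^ (n + 1)) :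
    K.toCapData.cap (n + 1) j ⊆ K.toCapData.cap n (j / 2) := by
  have hj' : j / 2 < 2 ^ n := by rw [pow_succ] at hj; omega
  obtain ⟨k, h0, h1, hk⟩ := K.height_succ hj
  unfold CapData.cap
  rw [hk]
  rcases Nat.even_or_odd' j with ⟨i, rfl | rfl⟩
  · rw [show 2 * i / 2 = i by omega] at hj' ⊢
    rw [CapData.side_left]
    exact triCap_left_subset _ (K.height_sq_le hj') h0 h1
  · rw [show (2 * i + 1) / 2 = i by omega] at hj' ⊢
    rw [CapData.side_right]
    exact triCap_right_subset _ (K.height_sq_le hj') h0 h1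

theorem cap_add_subset {n m j : ℕ} (hj : j < 2 ^ (n + m)) :
    K.toCapData.cap (n + m) j ⊆ K.toCapData.cap n (j / 2 ^ m) := by
  induction m generalizing j with
  | zero => simp
  | succ m ih =>
    have hj' : j / 2 < 2 ^ (n + m) := by rw [← add_assoc, pow_succ] at hj; omega
    refine (K.cap_succ_subset hj).trans ((ih hj').trans ?_)
    rw [Nat.div_div_eq_div_mul, pow_succ']

/-- The length of the base `A_{n,i}`. -/
noncomputable def len (n i : ℕ) : ℝ := dist (K.toCapData.side n i).1 (K.toCapData.side n i).2

theorem len_nonneg (n i : ℕ) : 0 ≤ K.len n i := dist_nonneg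

theorem len_zero (i : ℕ) : K.len 0 i = dist K.p K.q := rfl

theorem len_succ (n j : ℕ) :
    K.len (n + 1) j = sideRatio (K.θ n (j / 2)) * K.len n (j / 2) := by
  unfold len
  rcases Nat.even_or_odd' j with ⟨i, rfl | rfl⟩
  · rw [CapData.side_left, show 2 * i / 2 = i by omega, ← sqrt_height]
    exact dist_fst_capApex (K.toCapData.height n i) (K.toCapData.side n i)
  · rw [CapData.side_right, show (2 * i + 1) / 2 = i by omega, ← sqrt_height]
    exact dist_capApex_snd (K.toCapData.height n i) (K.toCapData.side n i)

theorem len_le {n i : ℕ} (hi : i < 2 ^ n) : K.len n i ≤ dist K.p K.q * (3 / 5) ^ n := by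
  induction n generalizing i with
  | zero => simp [len_zero]
  | succ n ih =>
    have hi' : i / 2 < 2 ^ n := by rw [pow_succ] at hi; omega
    rw [len_succ, pow_succ]
    have := K.sideRatio_le (K.θ_nonneg _ _ hi') (K.θ_le_θ_zero hi')
    calc _ ≤ 3 / 5 * (dist K.p K.q * (3 / 5) ^ n) := by
          exact mul_le_mul this (ih hi') (K.len_nonneg _ _) (by norm_num)
      _ = _ := by ring

theorem dist_le_len {n i : ℕ} (hi : i < 2 ^ n) {x y : ℂ} (hx : x ∈ K.toCapData.cap n i)
    (hy : y ∈ K.toCapData.cap n i) : dist x y ≤ K.len n i :=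
  dist_le_of_mem_triCap (K.height_sq_le hi) hx hy

theorem eq_of_forall_dist_le_len {x y : ℂ} {N : ℕ} {b : ℕ → ℕ} (hb : ∀ n, b n < 2 ^ n)
    (h : ∀ n ≥ N, dist x y ≤ K.len n (b n)) : x = y := by
  refine dist_le_zero.1 (ge_of_tendsto (x := atTop)
    (f := fun n : ℕ => dist K.p K.q * (3 / 5 : ℝ) ^ n) ?_ ?_)
  · have := (tendsto_pow_atTop_nhds_zero_of_lt_one (r := (3 / 5 : ℝ)) (by norm_num)
      (by norm_num)).const_mul (dist K.p K.q)
    rwa [mul_zero] at this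
  · filter_upwards [eventually_ge_atTop N] with n hn
    exact (h n hn).trans (K.len_le (hb n))

/-! ### The limit parametrisation -/

theorem polygon_mem_cap {t : ℝ} (ht : t ∈ Icc (0 : ℝ) 1) (n : ℕ) :
    K.toCapData.polygon n t ∈ K.toCapData.cap n (dyadicIndex n t) := by
  have h1 := dyadicIndex_le ht.1 n
  have h2 := le_dyadicIndex_add_one ht.2 n
  exact (convex_triCap _ _).segment_subset (fst_mem_triCap _ _) (snd_mem_triCap _ _)
    (by
      rw [segment_eq_image_lineMap]
      exact mem_image_of_mem _ ⟨by linarith, by linarith⟩)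

theorem cap_dyadicIndex_anti (t : ℝ) :
    Antitone fun n => K.toCapData.cap n (dyadicIndex n t) :=
  antitone_nat_of_succ_le fun n => by
    have := K.cap_succ_subset (dyadicIndex_lt (n + 1) t)
    rwa [dyadicIndex_div_two] at this

theorem tendsto_polygon {t : ℝ} (ht : t ∈ Icc (0 : ℝ) 1) :
    Tendsto (fun n => K.toCapData.polygon n t) atTop (𝓝 (K.toCapData.limitMap t)) := by
  refine CauchySeq.tendsto_limUnder (cauchySeq_of_le_geometric (3 / 5) (dist K.p K.q)
    (by norm_num) fun n => ?_)
  exact (K.dist_le_len (dyadicIndex_lt n t) (K.polygon_mem_cap ht n)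
    (K.cap_dyadicIndex_anti t n.le_succ (K.polygon_mem_cap ht (n + 1)))).trans
      (K.len_le (dyadicIndex_lt n t))

theorem limitMap_mem_cap {t : ℝ} (ht : t ∈ Icc (0 : ℝ) 1) (n : ℕ) :
    K.toCapData.limitMap t ∈ K.toCapData.cap n (dyadicIndex n t) := by
  refine (isClosed_triCap _ _).mem_of_tendsto (K.tendsto_polygon ht) ?_
  filter_upwards [eventually_ge_atTop n] with m hm
  exact K.cap_dyadicIndex_anti t hm (K.polygon_mem_cap ht m)

theorem limitMap_mem_limitSet {t : ℝ} (ht : t ∈ Icc (0 : ℝ) 1) :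
    K.toCapData.limitMap t ∈ K.toCapData.limitSet :=
  mem_iInter.2 fun n => mem_biUnion (Finset.mem_coe.2 (Finset.mem_range.2 (dyadicIndex_lt n t)))
    (K.limitMap_mem_cap ht n)

theorem countable_edgePoints (D : CapData) : D.edgePoints.Countable := by
  refine (to_countable _).biUnion fun n _ => (Finset.countable_toSet _).biUnion fun i _ => ?_
  exact (Set.toFinite _).countable

/-- A point of the limit set lies in the caps along an infinite branch of the binary tree, by
König's lemma. -/
theorem exists_branch {z : ℂ} (hz : z ∈ K.toCapData.limitSet) :
    ∃ b : ℕ → ℕ, (∀ n, b n < 2 ^ n) ∧ (∀ n, b (n + 1) / 2 = b n) ∧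
      ∀ n, z ∈ K.toCapData.cap n (b n) := by
  classical
  -- The index `i` is alive if caps of all later generations below `T_{n,i}` contain `z`.
  let alive : ℕ → ℕ → Prop := fun n i =>
    ∀ m, ∃ j < 2 ^ (n + m), j / 2 ^ m = i ∧ z ∈ K.toCapData.cap (n + m) j
  have h0 : alive 0 0 := by
    intro m
    obtain ⟨j, hj, hzj⟩ := mem_iUnion₂.1 (mem_iInter.1 hz (0 + m))
    have hj : j < 2 ^ (0 + m) := by simpa using hj
    refine ⟨j, hj, Nat.div_eq_of_lt ?_, hzj⟩
    rwa [zero_add] at hj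
  have hstep : ∀ n i, alive n i → ¬ alive (n + 1) (2 * i) → alive (n + 1) (2 * i + 1) := by
    intro n i hni hl
    by_contra hr
    simp only [alive, not_forall] at hl hr
    obtain ⟨m₁, h₁⟩ := hl
    obtain ⟨m₂, h₂⟩ := hr
    obtain ⟨j, hj, hji, hzj⟩ := hni (max m₁ m₂ + 1)
    have hdesc : ∀ m ≤ max m₁ m₂, ∃ j' < 2 ^ (n + 1 + m),
        j' / 2 ^ m = j / 2 ^ max m₁ m₂ ∧ z ∈ K.toCapData.cap (n + 1 + m) j' := by
      intro m hm
      obtain ⟨d, hd⟩ := Nat.exists_eq_add_of_le hm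
      have e : n + (max m₁ m₂ + 1) = n + 1 + m + d := by omega
      rw [e] at hj hzj
      refine ⟨j / 2 ^ d, ?_, ?_, K.cap_add_subset hj hzj⟩
      · rw [Nat.div_lt_iff_lt_mul (by positivity), ← pow_add]
        exact hj
      · rw [Nat.div_div_eq_div_mul, ← pow_add, hd, add_comm d]
    have hc : j / 2 ^ max m₁ m₂ = 2 * i ∨ j / 2 ^ max m₁ m₂ = 2 * i + 1 := by
      rw [pow_succ, ← Nat.div_div_eq_div_mul] at hji
      omega
    rcases hc with hc | hc
    · exact h₁ (hc ▸ hdesc m₁ (le_max_left _ _))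
    · exact h₂ (hc ▸ hdesc m₂ (le_max_right _ _))
  let b : ℕ → ℕ := fun n =>
    Nat.rec 0 (fun n i => if alive (n + 1) (2 * i) then 2 * i else 2 * i + 1) n
  have hb : ∀ n, b (n + 1) = if alive (n + 1) (2 * b n) then 2 * b n else 2 * b n + 1 :=
    fun n => rfl
  have hal : ∀ n, alive n (b n) := by
    intro n
    induction n with
    | zero => exact h0
    | succ n ih =>
      rw [hb]
      split_ifs with h
      · exact h
      · exact hstep n _ ih h
  refine ⟨b, fun n => ?_, fun n => ?_, fun n => ?_⟩
  · obtain ⟨j, hj, hjb, -⟩ := hal n 0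
    simpa [← hjb] using hj
  · rw [hb]
    split_ifs <;> omega
  · obtain ⟨j, -, hjb, hzj⟩ := hal n 0
    simpa [← hjb] using hzj

/-- The limit set consists of the image of the limit parametrisation and of countably many right
end points of bases, the limits of the branches that turn to the right from some generation on. -/
theorem limitSet_subset : K.toCapData.limitSet ⊆ K.toCapData.limitMap '' Icc 0 1 ∪
    range fun a : ℕ × ℕ => (K.toCapData.side a.1 a.2).2 := by
  intro z hz
  obtain ⟨b, hlt, hdiv, hzb⟩ := K.exists_branch hz
  have hpow : ∀ n, (0 : ℝ) < 2 ^ n := fun n => by positivity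
  have hanti : Antitone fun n => Icc ((b n : ℝ) / 2 ^ n) ((b n + 1) / 2 ^ n) := by
    refine antitone_nat_of_succ_le fun n => Icc_subset_Icc ?_ ?_
    · rw [div_le_div_iff₀ (hpow _) (hpow _), pow_succ]
      have : 2 * b n ≤ b (n + 1) := by have := hdiv n; omega
      have : (2 * b n : ℝ) ≤ b (n + 1) := by exact_mod_cast this
      nlinarith [hpow n]
    · rw [div_le_div_iff₀ (hpow _) (hpow _), pow_succ]
      have : b (n + 1) ≤ 2 * b n + 1 := by have := hdiv n; omega
      have : (b (n + 1) : ℝ) ≤ 2 * b n + 1 := by exact_mod_cast this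
      nlinarith [hpow n]
  have hmem := ciSup_mem_iInter_Icc_of_antitone_Icc hanti
    fun n => div_le_div_of_nonneg_right (by linarith) (hpow n).le
  set t := ⨆ n, (b n : ℝ) / 2 ^ n
  have hl : ∀ n, (b n : ℝ) ≤ 2 ^ n * t := fun n => by
    have := (mem_iInter.1 hmem n).1
    rwa [div_le_iff₀' (hpow n)] at this
  have hr : ∀ n, 2 ^ n * t ≤ b n + 1 := fun n => by
    have := (mem_iInter.1 hmem n).2
    rwa [le_div_iff₀' (hpow n)] at this
  have hb0 : b 0 = 0 := by simpa using hlt 0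
  have ht : t ∈ Icc (0 : ℝ) 1 := by
    have h1 := hl 0
    have h2 := hr 0
    simp only [hb0, pow_zero, one_mul, Nat.cast_zero, zero_add] at h1 h2
    exact ⟨h1, h2⟩
  by_cases hall : ∀ n, dyadicIndex n t = b n
  · left
    refine ⟨t, ht, K.eq_of_forall_dist_le_len (N := 0) hlt fun n _ => ?_⟩
    have := K.limitMap_mem_cap ht n
    rw [hall n] at this
    exact K.dist_le_len (hlt n) this (hzb n)
  · right
    push Not at hall
    obtain ⟨n, hn⟩ := hall
    have htn : 2 ^ n * t = b n + 1 :=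
      (hr n).antisymm (not_lt.1 fun h => hn (dyadicIndex_eq (hlt n) (hl n) h))
    have hm : ∀ m ≥ n, 2 ^ m * t = b m + 1 ∧
        (K.toCapData.side m (b m)).2 = (K.toCapData.side n (b n)).2 := by
      intro m hm
      induction m, hm using Nat.le_induction with
      | base => exact ⟨htn, rfl⟩
      | succ m hm ih =>
        have h1 := hr (m + 1)
        have e : 2 ^ (m + 1) * t = 2 * (b m + 1) := by rw [pow_succ, ← ih.1]; ring
        have h2 : (2 * b m + 1 : ℝ) ≤ b (m + 1) := by linarith
        have h2 : 2 * b m + 1 ≤ b (m + 1) := by exact_mod_cast h2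
        have h3 : b (m + 1) = 2 * b m + 1 := by have := hdiv m; omega
        refine ⟨?_, ?_⟩
        · rw [e, h3]; push_cast; ring
        · rw [h3, CapData.side_right]; exact ih.2
    refine ⟨(n, b n), K.eq_of_forall_dist_le_len (N := n) hlt fun m hmn => ?_⟩
    refine K.dist_le_len (hlt m) ?_ (hzb m)
    change (K.toCapData.side n (b n)).2 ∈ _
    rw [← (hm m hmn).2]
    exact snd_mem_triCap _ _

/-! ### Separation of the points of the limit set -/

/-- A parameter `t` to the right of the left end of its dyadic interval leaves that end point, by
passing to a right half, at a scale `2⁻ᵐ` not below their distance. -/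
theorem half_len_le_dist_fst {t : ℝ} (ht : t ∈ Icc (0 : ℝ) 1) (n : ℕ)
    (h : (dyadicIndex n t : ℝ) < 2 ^ n * t) :
    ∃ m, t - dyadicIndex n t / 2 ^ n ≤ 1 / 2 ^ m ∧
      K.len m (dyadicIndex m t) / 2 ≤
        dist (K.toCapData.limitMap t) (K.toCapData.side n (dyadicIndex n t)).1 := by
  have hpow : ∀ n, (0 : ℝ) < 2 ^ n := fun n => by positivity
  have hsub : ∀ n, t - (dyadicIndex n t : ℝ) / 2 ^ n ≤ 1 / 2 ^ n := fun n => by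
    rw [sub_le_iff_le_add, ← add_div, le_div_iff₀' (hpow n), add_comm (1 : ℝ)]
    exact le_dyadicIndex_add_one ht.2 n
  have hpos : 0 < t - (dyadicIndex n t : ℝ) / 2 ^ n := by
    rw [sub_pos, div_lt_iff₀' (hpow n)]; exact h
  obtain ⟨k, hk⟩ := exists_pow_lt_of_lt_one hpos (show (1 / 2 : ℝ) < 1 by norm_num)
  replace hk : (1 / 2 : ℝ) ^ (n + k) < t - (dyadicIndex n t : ℝ) / 2 ^ n :=
    (pow_le_pow_of_le_one (by norm_num) (by norm_num) (by omega)).trans_lt hk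
  clear h hpos
  induction k generalizing n with
  | zero =>
    have := hsub n
    rw [add_zero, one_div_pow] at hk
    linarith
  | succ k ih =>
    rcases dyadicIndex_succ n t with h | h
    · have e : (dyadicIndex (n + 1) t : ℝ) / 2 ^ (n + 1) = dyadicIndex n t / 2 ^ n := by
        rw [h, pow_succ]; push_cast; field_simp
      have := ih (n + 1) (by rw [e]; convert hk using 2; omega)
      rwa [e, h, CapData.side_left] at this
    · refine ⟨n, hsub n, half_le_dist_fst (K.abs_height_le (dyadicIndex_lt n t))
        (K.abs_height_le (dyadicIndex_lt (n + 1) t)) ?_⟩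
      have := K.limitMap_mem_cap ht (n + 1)
      rw [CapData.cap] at this
      convert this using 1
      rw [h, CapData.side_right]

/-- The mirror image of `half_len_le_dist_fst`. -/
theorem half_len_le_dist_snd {t : ℝ} (ht : t ∈ Icc (0 : ℝ) 1) (n : ℕ)
    (h : 2 ^ n * t < dyadicIndex n t + 1) :
    ∃ m, (dyadicIndex n t + 1) / 2 ^ n - t ≤ 1 / 2 ^ m ∧
      K.len m (dyadicIndex m t) / 2 ≤
        dist (K.toCapData.limitMap t) (K.toCapData.side n (dyadicIndex n t)).2 := by
  have hpow : ∀ n, (0 : ℝ) < 2 ^ n := fun n => by positivity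
  have hsub : ∀ n, ((dyadicIndex n t : ℝ) + 1) / 2 ^ n - t ≤ 1 / 2 ^ n := fun n => by
    rw [add_div, sub_le_iff_le_add, add_comm, add_le_add_iff_left, div_le_iff₀' (hpow n)]
    exact dyadicIndex_le ht.1 n
  have hpos : 0 < ((dyadicIndex n t : ℝ) + 1) / 2 ^ n - t := by
    rw [sub_pos, lt_div_iff₀' (hpow n)]; exact h
  obtain ⟨k, hk⟩ := exists_pow_lt_of_lt_one hpos (show (1 / 2 : ℝ) < 1 by norm_num)
  replace hk : (1 / 2 : ℝ) ^ (n + k) < ((dyadicIndex n t : ℝ) + 1) / 2 ^ n - t :=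
    (pow_le_pow_of_le_one (by norm_num) (by norm_num) (by omega)).trans_lt hk
  clear h hpos
  induction k generalizing n with
  | zero =>
    have := hsub n
    rw [add_zero, one_div_pow] at hk
    linarith
  | succ k ih =>
    rcases dyadicIndex_succ n t with h | h
    · refine ⟨n, hsub n, half_le_dist_snd (K.abs_height_le (dyadicIndex_lt n t))
        (K.abs_height_le (dyadicIndex_lt (n + 1) t)) ?_⟩
      have := K.limitMap_mem_cap ht (n + 1)
      rw [CapData.cap] at this
      convert this using 1
      rw [h, CapData.side_left]
    · have e : ((dyadicIndex (n + 1) t : ℝ) + 1) / 2 ^ (n + 1) =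
          (dyadicIndex n t + 1) / 2 ^ n := by
        rw [h, pow_succ]; push_cast; field_simp; ring
      have := ih (n + 1) (by rw [e]; convert hk using 2; omega)
      rwa [e, h, CapData.side_right] at this

/-- Images of two parameters are at least as far apart as half the base of a cap around one of
them, of a generation `m` at whose scale `2⁻ᵐ` the two parameters are close. At the first dyadic
midpoint that separates the parameters, the two pieces form an obtuse angle, so it suffices to
bound the distance from that vertex to the image of the parameter farther from the midpoint. -/
theorem exists_half_len_le_dist {x y : ℝ} (hx : x ∈ Icc (0 : ℝ) 1) (hy : y ∈ Icc (0 : ℝ) 1)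
    (hxy : x < y) :
    ∃ z, (z = x ∨ z = y) ∧ ∃ m, y - x ≤ 2 * (1 / 2 ^ m) ∧
      K.len m (dyadicIndex m z) / 2 ≤
        dist (K.toCapData.limitMap x) (K.toCapData.limitMap y) := by
  have hpow : ∀ n, (0 : ℝ) < 2 ^ n := fun n => by positivity
  obtain ⟨N, hN⟩ := exists_pow_lt_of_lt_one (sub_pos.2 hxy) (show (1 / 2 : ℝ) < 1 by norm_num)
  have hex : ∃ n, dyadicIndex n x ≠ dyadicIndex n y := by
    refine ⟨N, fun h => ?_⟩
    have h1 := dyadicIndex_le hx.1 N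
    have h2 := le_dyadicIndex_add_one hy.2 N
    rw [h] at h1
    rw [one_div_pow, div_lt_iff₀' (hpow N)] at hN
    nlinarith
  classical
  obtain ⟨n, hn, hmin⟩ : ∃ n, dyadicIndex (n + 1) x ≠ dyadicIndex (n + 1) y ∧
      dyadicIndex n x = dyadicIndex n y := by
    have h0 : Nat.find hex ≠ 0 := fun h => by
      have h1 := Nat.find_spec hex
      rw [h] at h1
      have := dyadicIndex_lt 0 x
      have := dyadicIndex_lt 0 y
      omega
    obtain ⟨n, hn⟩ := Nat.exists_eq_succ_of_ne_zero h0
    refine ⟨n, ?_, not_not.1 (Nat.find_min hex (by omega))⟩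
    have h1 := Nat.find_spec hex
    rwa [hn] at h1
  have hle := dyadicIndex_mono (n + 1) hxy.le
  have hix : dyadicIndex (n + 1) x = 2 * dyadicIndex n x := by
    rcases dyadicIndex_succ n x with h | h <;> rcases dyadicIndex_succ n y with h' | h' <;> omega
  have hiy : dyadicIndex (n + 1) y = 2 * dyadicIndex n x + 1 := by
    rcases dyadicIndex_succ n x with h | h <;> rcases dyadicIndex_succ n y with h' | h' <;> omega
  have hFx := K.limitMap_mem_cap hx (n + 1)
  have hFy := K.limitMap_mem_cap hy (n + 1)
  have hhx := K.abs_height_le (dyadicIndex_lt (n + 1) x)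
  have hhy := K.abs_height_le (dyadicIndex_lt (n + 1) y)
  rw [hix] at hFx hhx
  rw [hiy] at hFy hhy
  unfold CapData.cap at hFx hFy
  rw [CapData.side_left] at hFx
  rw [CapData.side_right] at hFy
  obtain ⟨hdx, hdy⟩ := dist_apex_le_dist (K.abs_height_le (dyadicIndex_lt n x)) hhx hhy hFx hFy
  set M : ℝ := (2 * dyadicIndex n x + 1) / 2 ^ (n + 1) with hM
  rcases le_or_gt (y - x) (2 * (M - x)) with h | h
  · have e : ((dyadicIndex (n + 1) x : ℝ) + 1) / 2 ^ (n + 1) = M := by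
      rw [hix, hM]; push_cast; ring
    obtain ⟨m, h1, h2⟩ := K.half_len_le_dist_snd hx (n + 1) (by
      rw [← lt_div_iff₀' (hpow _), e]; linarith)
    rw [e] at h1
    rw [hix, CapData.side_left] at h2
    exact ⟨x, Or.inl rfl, m, by linarith, h2.trans hdx⟩
  · have e : (dyadicIndex (n + 1) y : ℝ) / 2 ^ (n + 1) = M := by
      rw [hiy, hM]; push_cast; ring
    obtain ⟨m, h1, h2⟩ := K.half_len_le_dist_fst hy (n + 1) (by
      rw [← div_lt_iff₀' (hpow _), e]; linarith)
    rw [e] at h1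
    rw [hiy, CapData.side_right] at h2
    exact ⟨y, Or.inr rfl, m, by linarith, h2.trans hdy⟩

end KochConstruction

namespace KochConstruction

variable (K : KochConstruction)

open scoped NNReal ENNReal

/-! ### From lengths of bases to Hausdorff dimensions -/

theorem rpow_log_two_div {r : ℝ} (h0 : 0 < r) (h1 : r < 1) :
    r ^ (-(Real.log 2 / Real.log r)) = 1 / 2 := by
  have h := (Real.log_neg h0 h1).ne
  rw [Real.rpow_def_of_pos h0, show Real.log r * -(Real.log 2 / Real.log r) = -Real.log 2 by
    field_simp, Real.exp_neg, Real.exp_log two_pos, one_div]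

theorem pow_rpow_log_two_div {r : ℝ} (h0 : 0 < r) (h1 : r < 1) (n : ℕ) :
    (r ^ n) ^ (-(Real.log 2 / Real.log r)) = 1 / 2 ^ n := by
  rw [← Real.rpow_natCast, ← Real.rpow_mul h0.le, mul_comm, Real.rpow_mul h0.le,
    rpow_log_two_div h0 h1, Real.rpow_natCast, one_div_pow]

theorem log_two_div_pos {r : ℝ} (h0 : 0 < r) (h1 : r < 1) :
    0 < -(Real.log 2 / Real.log r) :=
  neg_pos.2 (div_neg_of_pos_of_neg (Real.log_pos one_lt_two) (Real.log_neg h0 h1))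

/-- The caps of generation `n` around a set of limit points form a cover by `2 ^ n` sets of
diameter `O(r ^ n)`. -/
theorem dimH_limitMap_le_of_len_le {S : Set ℝ} (hS : S ⊆ Icc 0 1) {r C : ℝ} (h0 : 0 < r)
    (h1 : r < 1) (hC : 0 ≤ C) (h : ∀ t ∈ S, ∀ n, K.len n (dyadicIndex n t) ≤ C * r ^ n) :
    dimH (K.toCapData.limitMap '' S) ≤ ENNReal.ofReal (-(Real.log 2 / Real.log r)) := by
  have hd := log_two_div_pos h0 h1
  have hpow := pow_rpow_log_two_div h0 h1
  set d := -(Real.log 2 / Real.log r)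
  let cover : ∀ n : ℕ, Fin (2 ^ n) → Set ℂ := fun n i =>
    K.toCapData.limitMap '' {t ∈ S | dyadicIndex n t = i}
  have hdiam : ∀ n i, Metric.ediam (cover n i) ≤ ENNReal.ofReal (C * r ^ n) := by
    intro n i
    refine Metric.ediam_le ?_
    rintro _ ⟨t, ⟨ht, hti⟩, rfl⟩ _ ⟨u, ⟨hu, hui⟩, rfl⟩
    rw [edist_dist]
    refine ENNReal.ofReal_le_ofReal (le_trans (K.dist_le_len i.2 ?_ ?_) (hti ▸ h t ht n))
    · exact hti ▸ K.limitMap_mem_cap (hS ht) n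
    · exact hui ▸ K.limitMap_mem_cap (hS hu) n
  have hlim : Tendsto (fun n : ℕ => ENNReal.ofReal (C * r ^ n)) atTop (𝓝 0) := by
    have := (tendsto_pow_atTop_nhds_zero_of_lt_one h0.le h1).const_mul C
    rw [mul_zero] at this
    simpa using ENNReal.tendsto_ofReal this
  have hsum : ∀ n, ∑ i, Metric.ediam (cover n i) ^ d ≤ ENNReal.ofReal (C ^ d) := by
    intro n
    calc ∑ i, Metric.ediam (cover n i) ^ d
        ≤ ∑ _i : Fin (2 ^ n), ENNReal.ofReal (C * r ^ n) ^ d :=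
          Finset.sum_le_sum fun i _ => ENNReal.rpow_le_rpow (hdiam n i) hd.le
      _ = ENNReal.ofReal (2 ^ n * (C * r ^ n) ^ d) := by
          rw [Finset.sum_const, Finset.card_univ, Fintype.card_fin, nsmul_eq_mul,
            ENNReal.ofReal_rpow_of_nonneg (by positivity) hd.le,
            ENNReal.ofReal_mul (by positivity)]
          congr 1
          rw [ENNReal.ofReal_pow (by norm_num)]
          simp
      _ = ENNReal.ofReal (C ^ d) := by
          rw [Real.mul_rpow hC (by positivity), hpow]
          congr 1
          field_simp
  refine dimH_le_of_hausdorffMeasure_ne_top (d := d.toNNReal) (ne_top_of_le_ne_top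
    (b := ENNReal.ofReal (C ^ d)) ENNReal.ofReal_ne_top ?_)
  rw [Real.coe_toNNReal d hd.le]
  refine (Measure.hausdorffMeasure_le_liminf_sum d _ _ hlim cover
    (Eventually.of_forall hdiam) (Eventually.of_forall fun n => ?_)).trans ?_
  · rintro _ ⟨t, ht, rfl⟩
    exact mem_iUnion.2 ⟨⟨dyadicIndex n t, dyadicIndex_lt n t⟩, t, ⟨ht, rfl⟩, rfl⟩
  · exact (liminf_le_liminf (Eventually.of_forall hsum)).trans (liminf_const _).le

/-- Where the bases have length at least `c * r ^ n`, the inverse of the limit parametrisation is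
Hölder continuous with exponent `-ln 2 / ln r`. -/
theorem sub_le_of_le_len {S : Set ℝ} (hS : S ⊆ Icc 0 1) {r c : ℝ} (h0 : 0 < r) (h1 : r < 1)
    (hc : 0 < c) (h : ∀ t ∈ S, ∀ n, c * r ^ n ≤ K.len n (dyadicIndex n t)) {x y : ℝ} (hx : x ∈ S)
    (hy : y ∈ S) :
    dist x y ≤ 2 * (2 / c) ^ (-(Real.log 2 / Real.log r)) *
      dist (K.toCapData.limitMap x) (K.toCapData.limitMap y) ^
        (-(Real.log 2 / Real.log r)) := by
  have hd := log_two_div_pos h0 h1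
  have hpow := pow_rpow_log_two_div h0 h1
  set d := -(Real.log 2 / Real.log r)
  wlog hxy : x < y generalizing x y
  · rcases (not_lt.1 hxy).eq_or_lt with rfl | hxy
    · rw [dist_self]; positivity
    · rw [dist_comm x, dist_comm (K.toCapData.limitMap x)]
      exact this hy hx hxy
  obtain ⟨z, hz, m, h2, h3⟩ := K.exists_half_len_le_dist (hS hx) (hS hy) hxy
  have hz : z ∈ S := by rcases hz with rfl | rfl <;> assumption
  have h4 : r ^ m ≤ 2 / c * dist (K.toCapData.limitMap x) (K.toCapData.limitMap y) := by
    have := h z hz m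
    rw [div_mul_eq_mul_div, le_div_iff₀ hc]
    linarith
  rw [dist_comm, Real.dist_eq, abs_of_pos (sub_pos.2 hxy)]
  calc y - x ≤ 2 * (1 / 2 ^ m) := h2
    _ = 2 * (r ^ m) ^ d := by rw [hpow]
    _ ≤ 2 * (2 / c * dist (K.toCapData.limitMap x) (K.toCapData.limitMap y)) ^ d := by gcongr
    _ = _ := by rw [Real.mul_rpow (by positivity) dist_nonneg, mul_assoc]

theorem dist_basePoint (x y : ℝ) :
    dist (K.toCapData.basePoint x) (K.toCapData.basePoint y) = dist x y * dist K.p K.q :=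
  dist_lineMap_lineMap _ _ _ _

theorem le_dimH_limitMap_of_le_len {S : Set ℝ} (hS : S ⊆ Icc 0 1) {r c : ℝ} (h0 : 0 < r)
    (h1 : r < 1) (hc : 0 < c) (h : ∀ t ∈ S, ∀ n, c * r ^ n ≤ K.len n (dyadicIndex n t))
    (hpos : μH[1] (K.toCapData.basePoint '' S) ≠ 0) :
    ENNReal.ofReal (-(Real.log 2 / Real.log r)) ≤ dimH (K.toCapData.limitMap '' S) := by
  have hd := log_two_div_pos h0 h1
  have key := fun {x y : ℝ} => K.sub_le_of_le_len (x := x) (y := y) hS h0 h1 hc h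
  set d := -(Real.log 2 / Real.log r)
  have hinj : InjOn K.toCapData.limitMap S := by
    intro x hx y hy hxy
    have := key hx hy
    rw [hxy, dist_self, Real.zero_rpow hd.ne', mul_zero] at this
    exact dist_le_zero.1 this
  let g : ℂ → ℂ := fun z => K.toCapData.basePoint (Function.invFunOn K.toCapData.limitMap S z)
  have hinv := hinj.leftInvOn_invFunOn
  have hg : g '' (K.toCapData.limitMap '' S) = K.toCapData.basePoint '' S := by
    rw [image_image]
    exact image_congr fun t ht => congrArg K.toCapData.basePoint (hinv ht)
  have hC : 0 ≤ dist K.p K.q * (2 * (2 / c) ^ d) := by positivity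
  have hholder : HolderOnWith (dist K.p K.q * (2 * (2 / c) ^ d)).toNNReal d.toNNReal g
      (K.toCapData.limitMap '' S) := by
    rintro _ ⟨x, hx, rfl⟩ _ ⟨y, hy, rfl⟩
    simp only [g, hinv hx, hinv hy]
    rw [edist_dist, edist_dist, Real.coe_toNNReal d hd.le,
      ENNReal.ofReal_rpow_of_nonneg dist_nonneg hd.le]
    change _ ≤ ENNReal.ofReal _ * _
    rw [← ENNReal.ofReal_mul hC, dist_basePoint]
    refine ENNReal.ofReal_le_ofReal ?_
    have := mul_le_mul_of_nonneg_right (key hx hy) (dist_nonneg (x := K.p) (y := K.q))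
    linarith
  have hone : 1 ≤ dimH (K.toCapData.basePoint '' S) := by
    have := le_dimH_of_hausdorffMeasure_ne_zero (d := 1) (by simpa using hpos)
    simpa using this
  have hle := hholder.dimH_image_le (Real.toNNReal_pos.2 hd)
  rw [hg] at hle
  have := hone.trans hle
  rw [ENNReal.le_div_iff_mul_le (Or.inl (by simpa using hd)) (Or.inl (by simp)), one_mul] at this
  exact this

end KochConstruction

namespace KochConstruction

variable (K : KochConstruction)

/-! ### Limiting base angles -/

theorem θ_dyadicIndex_anti (t : ℝ) : Antitone fun n => K.θ n (dyadicIndex n t) :=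
  antitone_nat_of_succ_le fun n => by
    have := K.θ_succ_le (dyadicIndex_lt (n + 1) t)
    rwa [dyadicIndex_div_two] at this

theorem θ_dyadicIndex_nonneg (n : ℕ) (t : ℝ) : 0 ≤ K.θ n (dyadicIndex n t) :=
  K.θ_nonneg n _ (dyadicIndex_lt n t)

theorem tendsto_θ (t : ℝ) :
    Tendsto (fun n => K.θ n (dyadicIndex n t)) atTop (𝓝 (K.limitAngle t)) :=
  tendsto_nhds_limUnder ⟨_, tendsto_atTop_ciInf (K.θ_dyadicIndex_anti t)
    ⟨0, by rintro _ ⟨n, rfl⟩; exact K.θ_dyadicIndex_nonneg n t⟩⟩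

theorem limitAngle_le (n : ℕ) (t : ℝ) : K.limitAngle t ≤ K.θ n (dyadicIndex n t) :=
  (K.θ_dyadicIndex_anti t).le_of_tendsto (K.tendsto_θ t) n

theorem limitAngle_nonneg (t : ℝ) : 0 ≤ K.limitAngle t :=
  ge_of_tendsto' (K.tendsto_θ t) fun n => K.θ_dyadicIndex_nonneg n t

theorem limitAngle_le_θ_zero (t : ℝ) : K.limitAngle t ≤ K.θ 0 0 :=
  (K.limitAngle_le 0 t).trans (K.θ_le_θ_zero (dyadicIndex_lt 0 t))

theorem θ_zero_nonneg : 0 ≤ K.θ 0 0 := K.θ_nonneg 0 0 (by simp)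

theorem angleGe_anti : Antitone K.angleGe := fun _ _ h _ ht => ⟨ht.1, h.trans ht.2⟩

theorem angleGe_zero : K.angleGe 0 = Icc 0 1 :=
  Subset.antisymm (fun _ h => h.1) fun _ h => ⟨h, K.limitAngle_nonneg _⟩

theorem hausdorffMeasure_base_pos : 0 < μH[1] (K.toCapData.basePoint '' Icc 0 1) := by
  have h : μH[1] (K.toCapData.basePoint '' Icc 0 1) =
      nndist K.p K.q • μH[1] (Icc (0 : ℝ) 1) := hausdorffMeasure_lineMap_image _ _ _
  rw [h, hausdorffMeasure_real, Real.volume_Icc, sub_zero, ENNReal.ofReal_one, ENNReal.smul_def,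
    smul_eq_mul, mul_one]
  simpa [pos_iff_ne_zero] using K.p_ne_q

theorem le_θ_zero_of_hausdorffMeasure_pos {a : ℝ}
    (ha : 0 < μH[1] (K.toCapData.basePoint '' K.angleGe a)) : a ≤ K.θ 0 0 := by
  have : (K.angleGe a).Nonempty := by
    by_contra h
    rw [not_nonempty_iff_eq_empty.1 h] at ha
    simp at ha
  obtain ⟨t, ht⟩ := this
  exact ht.2.trans (K.limitAngle_le_θ_zero t)

theorem bddAbove_gamma₁ :
    BddAbove {a : ℝ | 0 < μH[1] (K.toCapData.basePoint '' K.angleGe a)} :=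
  ⟨K.θ 0 0, fun _ ha => K.le_θ_zero_of_hausdorffMeasure_pos ha⟩

theorem zero_mem_gamma₁ :
    (0 : ℝ) ∈ {a : ℝ | 0 < μH[1] (K.toCapData.basePoint '' K.angleGe a)} := by
  rw [mem_ofPred_eq, angleGe_zero]
  exact K.hausdorffMeasure_base_pos

theorem gamma₁_nonneg : 0 ≤ K.gamma₁ := le_csSup K.bddAbove_gamma₁ K.zero_mem_gamma₁

theorem gamma₁_le_θ_zero : K.gamma₁ ≤ K.θ 0 0 :=
  csSup_le ⟨0, K.zero_mem_gamma₁⟩ fun _ ha => K.le_θ_zero_of_hausdorffMeasure_pos ha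

theorem hausdorffMeasure_angleGe_pos {a : ℝ} (ha : a < K.gamma₁) :
    0 < μH[1] (K.toCapData.basePoint '' K.angleGe (max a 0)) := by
  obtain ⟨b, hb, hab⟩ := exists_lt_of_lt_csSup ⟨0, K.zero_mem_gamma₁⟩ ha
  rcases max_cases a 0 with ⟨h, -⟩ | ⟨h, -⟩ <;> rw [h]
  · exact lt_of_lt_of_le hb (measure_mono (image_mono (K.angleGe_anti hab.le)))
  · exact K.zero_mem_gamma₁

theorem hausdorffMeasure_angle_gt_gamma₁ :
    μH[1] (K.toCapData.basePoint '' {t ∈ Icc (0 : ℝ) 1 | K.gamma₁ < K.limitAngle t}) = 0 := by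
  have hsub : K.toCapData.basePoint '' {t ∈ Icc (0 : ℝ) 1 | K.gamma₁ < K.limitAngle t} ⊆
      ⋃ n : ℕ, K.toCapData.basePoint '' K.angleGe (K.gamma₁ + 1 / (n + 1)) := by
    rintro _ ⟨t, ⟨ht, hlt⟩, rfl⟩
    obtain ⟨n, hn⟩ := exists_nat_one_div_lt (sub_pos.2 hlt)
    exact mem_iUnion.2 ⟨n, mem_image_of_mem _ ⟨ht, by linarith⟩⟩
  refine measure_mono_null hsub (measure_iUnion_null fun n => ?_)
  by_contra h
  have h1 : K.gamma₁ + 1 / ((n : ℝ) + 1) ≤ K.gamma₁ :=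
    le_csSup K.bddAbove_gamma₁ (pos_iff_ne_zero.2 h)
  have : 0 < 1 / ((n : ℝ) + 1) := by positivity
  linarith

theorem limitAngle_le_gamma₂ {t : ℝ} (ht : t ∈ Icc (0 : ℝ) 1) : K.limitAngle t ≤ K.gamma₂ :=
  le_csSup ⟨K.θ 0 0, by rintro _ ⟨u, -, rfl⟩; exact K.limitAngle_le_θ_zero u⟩
    (mem_image_of_mem _ ht)

theorem gamma₂_nonneg : 0 ≤ K.gamma₂ :=
  (K.limitAngle_nonneg 0).trans (K.limitAngle_le_gamma₂ ⟨le_rfl, zero_le_one⟩)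

theorem gamma₂_le_θ_zero : K.gamma₂ ≤ K.θ 0 0 :=
  csSup_le ((nonempty_Icc.2 zero_le_one).image _)
    (by rintro _ ⟨u, -, rfl⟩; exact K.limitAngle_le_θ_zero u)

/-! ### The dimension function -/

theorem continuousAt_kochF₁ {γ : ℝ} (h0 : 0 ≤ γ) (h1 : γ ≤ K.θ 0 0) :
    ContinuousAt kochF₁ γ := by
  have hcos : Real.cos γ ≠ 0 :=
    (Real.cos_pos_of_mem_Ioo ⟨by linarith [Real.pi_pos], by linarith [K.θ_zero_lt]⟩).ne'
  have htan := Real.continuousAt_tan.2 hcos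
  have hpos := sideRatio_pos γ
  have hlog : Real.log (sideRatio γ) ≠ 0 :=
    (Real.log_neg hpos (K.sideRatio_lt_one h0 h1)).ne
  have hc : ContinuousAt sideRatio γ :=
    continuousAt_const.mul (Real.continuous_sqrt.continuousAt.comp
      (continuousAt_const.add (htan.pow 2)))
  exact (continuousAt_const.div (hc.log hpos.ne') hlog).neg

theorem one_le_kochF₁ {γ : ℝ} (h0 : 0 ≤ γ) (h1 : γ ≤ K.θ 0 0) : 1 ≤ kochF₁ γ := by
  change 1 ≤ -(Real.log 2 / Real.log (sideRatio γ))
  have hneg := Real.log_neg (sideRatio_pos γ) (K.sideRatio_lt_one h0 h1)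
  have := Real.log_le_log (by norm_num) (half_le_sideRatio γ)
  rw [one_div, Real.log_inv] at this
  rw [← div_neg, one_le_div (by linarith)]
  linarith

/-! ### Bounds for parts of the limit set -/

theorem le_len_of_le_limitAngle {a t : ℝ} (ha : 0 ≤ a) (h : a ≤ K.limitAngle t) (n : ℕ) :
    dist K.p K.q * sideRatio a ^ n ≤ K.len n (dyadicIndex n t) := by
  induction n with
  | zero => simp [len_zero]
  | succ n ih =>
    rw [len_succ, dyadicIndex_div_two]
    have := K.sideRatio_le_sideRatio ha (h.trans (K.limitAngle_le n t))
      (K.θ_le_θ_zero (dyadicIndex_lt n t))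
    calc dist K.p K.q * sideRatio a ^ (n + 1)
        = sideRatio a * (dist K.p K.q * sideRatio a ^ n) := by ring
      _ ≤ _ := mul_le_mul this ih (by have := sideRatio_pos a; positivity)
          (sideRatio_pos _).le

theorem len_le_of_θ_le {c t : ℝ} {N : ℕ} (hc : c ≤ K.θ 0 0)
    (h : ∀ n ≥ N, K.θ n (dyadicIndex n t) ≤ c) (n : ℕ) :
    K.len n (dyadicIndex n t) ≤ dist K.p K.q * 2 ^ N * sideRatio c ^ n := by
  have hpos := sideRatio_pos c
  have key : K.len n (dyadicIndex n t) ≤ dist K.p K.q * 2 ^ min n N * sideRatio c ^ n := by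
    induction n with
    | zero => simp [len_zero]
    | succ n ih =>
      rw [len_succ, dyadicIndex_div_two]
      have hstep : sideRatio (K.θ n (dyadicIndex n t)) * 2 ^ min n N ≤
          2 ^ min (n + 1) N * sideRatio c := by
        rcases lt_or_ge n N with hn | hn
        · rw [min_eq_left hn.le, min_eq_left (by omega), pow_succ]
          have h1 := K.sideRatio_le (K.θ_dyadicIndex_nonneg n t)
            (K.θ_le_θ_zero (dyadicIndex_lt n t))
          have h2 := half_le_sideRatio c
          have h3 : (0 : ℝ) < 2 ^ n := by positivity
          nlinarith
        · rw [min_eq_right hn, min_eq_right (by omega), mul_comm]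
          have := K.sideRatio_le_sideRatio (K.θ_dyadicIndex_nonneg n t) (h n hn) hc
          gcongr
      calc _ ≤ sideRatio (K.θ n (dyadicIndex n t)) *
            (dist K.p K.q * 2 ^ min n N * sideRatio c ^ n) :=
            mul_le_mul_of_nonneg_left ih (sideRatio_pos _).le
        _ = sideRatio (K.θ n (dyadicIndex n t)) * 2 ^ min n N *
            (dist K.p K.q * sideRatio c ^ n) := by ring
        _ ≤ 2 ^ min (n + 1) N * sideRatio c * (dist K.p K.q * sideRatio c ^ n) := by gcongr
        _ = _ := by ring
  refine key.trans ?_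
  gcongr
  · norm_num
  · exact min_le_right _ _

theorem dimH_limitMap_le_of_eventually {T : Set ℝ} (hT : T ⊆ Icc 0 1) {c : ℝ} (h0 : 0 ≤ c)
    (h1 : c ≤ K.θ 0 0) (h : ∀ t ∈ T, ∀ᶠ n in atTop, K.θ n (dyadicIndex n t) ≤ c) :
    dimH (K.toCapData.limitMap '' T) ≤ ENNReal.ofReal (kochF₁ c) := by
  have hsub : K.toCapData.limitMap '' T ⊆ ⋃ N : ℕ, K.toCapData.limitMap ''
      {t ∈ T | ∀ n ≥ N, K.θ n (dyadicIndex n t) ≤ c} := by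
    rintro _ ⟨t, ht, rfl⟩
    obtain ⟨N, hN⟩ := eventually_atTop.1 (h t ht)
    exact mem_iUnion.2 ⟨N, mem_image_of_mem _ ⟨ht, hN⟩⟩
  refine (dimH_mono hsub).trans ?_
  rw [dimH_iUnion]
  refine iSup_le fun N => ?_
  exact K.dimH_limitMap_le_of_len_le (fun t ht => hT ht.1) (C := dist K.p K.q * 2 ^ N)
    (sideRatio_pos c) (K.sideRatio_lt_one h0 h1) (by positivity)
    fun t ht n => K.len_le_of_θ_le h1 ht.2 n

theorem dimH_limitMap_le {T : Set ℝ} (hT : T ⊆ Icc 0 1) {γ : ℝ} (h0 : 0 ≤ γ)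
    (h1 : γ ≤ K.θ 0 0) (h : ∀ t ∈ T, K.limitAngle t ≤ γ) :
    dimH (K.toCapData.limitMap '' T) ≤ ENNReal.ofReal (kochF₁ γ) := by
  have hlim : Tendsto (fun c => ENNReal.ofReal (kochF₁ (min c (K.θ 0 0)))) (𝓝[>] γ)
      (𝓝 (ENNReal.ofReal (kochF₁ γ))) := by
    have hmin : Tendsto (fun c => min c (K.θ 0 0)) (𝓝 γ) (𝓝 γ) := by
      have := (continuous_id.min (continuous_const (y := K.θ 0 0))).tendsto γ
      simpa [min_eq_left h1] using this
    exact (ENNReal.tendsto_ofReal ((K.continuousAt_kochF₁ h0 h1).tendsto.comp hmin)).mono_left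
      nhdsWithin_le_nhds
  refine ge_of_tendsto hlim ?_
  filter_upwards [self_mem_nhdsWithin] with c hc
  refine K.dimH_limitMap_le_of_eventually hT (le_min (h0.trans (le_of_lt hc)) K.θ_zero_nonneg)
    (min_le_right _ _) fun t ht => ?_
  filter_upwards [(K.tendsto_θ t).eventually_lt_const ((h t ht).trans_lt hc)] with n hn
  exact le_min hn.le (K.θ_le_θ_zero (dyadicIndex_lt n t))

theorem le_dimH_limitMap {a : ℝ} (ha : 0 ≤ a) (h1 : a ≤ K.θ 0 0)
    (hpos : 0 < μH[1] (K.toCapData.basePoint '' K.angleGe a)) :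
    ENNReal.ofReal (kochF₁ a) ≤ dimH (K.toCapData.limitMap '' K.angleGe a) :=
  K.le_dimH_limitMap_of_le_len (c := dist K.p K.q) (fun _ h => h.1) (sideRatio_pos a)
    (K.sideRatio_lt_one ha h1) (dist_pos.2 K.p_ne_q)
    (fun _ ht n => K.le_len_of_le_limitAngle ha ht.2 n) hpos.ne'

/-! ### Koch type sets -/

variable {K} {A : Set ℂ}

theorem IsKochTypeSet.dimH_le (hA : K.IsKochTypeSet A) :
    dimH A ≤ dimH (K.toCapData.limitMap '' Icc 0 1) := by
  have hsub : A ⊆ K.toCapData.limitSet := by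
    rcases hA with rfl | rfl
    exacts [Subset.rfl, sdiff_subset]
  refine (dimH_mono (hsub.trans K.limitSet_subset)).trans ?_
  rw [dimH_union, dimH_countable (countable_range _)]
  exact max_le le_rfl zero_le

theorem IsKochTypeSet.dimH_limitMap_le (hA : K.IsKochTypeSet A) {S : Set ℝ} (hS : S ⊆ Icc 0 1) :
    dimH (K.toCapData.limitMap '' S) ≤ dimH A := by
  have hsub : K.toCapData.limitMap '' S ⊆ A ∪ K.toCapData.edgePoints := by
    rintro _ ⟨t, ht, rfl⟩
    have := K.limitMap_mem_limitSet (hS ht)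
    rcases hA with rfl | rfl
    · exact Or.inl this
    · by_cases h : K.toCapData.limitMap t ∈ K.toCapData.edgePoints
      exacts [Or.inr h, Or.inl ⟨this, h⟩]
  refine (dimH_mono hsub).trans ?_
  rw [dimH_union, dimH_countable (countable_edgePoints _)]
  exact max_le le_rfl zero_le

theorem IsKochTypeSet.kochF₁_gamma₁_le_dimH (hA : K.IsKochTypeSet A) :
    ENNReal.ofReal (kochF₁ K.gamma₁) ≤ dimH A := by
  have hlim : Tendsto (fun c => ENNReal.ofReal (kochF₁ (max c 0))) (𝓝[<] K.gamma₁)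
      (𝓝 (ENNReal.ofReal (kochF₁ K.gamma₁))) := by
    have hmax : Tendsto (fun c => max c 0) (𝓝 K.gamma₁) (𝓝 K.gamma₁) := by
      have := (continuous_id.max (continuous_const (y := (0 : ℝ)))).tendsto K.gamma₁
      simpa [max_eq_left K.gamma₁_nonneg] using this
    exact (ENNReal.tendsto_ofReal ((K.continuousAt_kochF₁ K.gamma₁_nonneg
      K.gamma₁_le_θ_zero).tendsto.comp hmax)).mono_left nhdsWithin_le_nhds
  refine le_of_tendsto hlim ?_
  filter_upwards [self_mem_nhdsWithin] with c hc
  have hpos := K.hausdorffMeasure_angleGe_pos hc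
  exact (K.le_dimH_limitMap (le_max_right _ _) (K.le_θ_zero_of_hausdorffMeasure_pos hpos)
    hpos).trans (hA.dimH_limitMap_le fun _ h => h.1)

theorem IsKochTypeSet.dimH_le_kochF₁_gamma₂ (hA : K.IsKochTypeSet A) :
    dimH A ≤ ENNReal.ofReal (kochF₁ K.gamma₂) :=
  hA.dimH_le.trans (K.dimH_limitMap_le Subset.rfl K.gamma₂_nonneg K.gamma₂_le_θ_zero
    fun _ ht => K.limitAngle_le_gamma₂ ht)

/-- Parameters with a limiting angle above `γ₁` do not affect the dimension if their image has
length zero, since the dimension in question is at least `1`. -/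
theorem IsKochTypeSet.dimH_le_kochF₁_gamma₁ (hA : K.IsKochTypeSet A)
    (h : μH[1] (K.toCapData.limitMap '' {t ∈ Icc (0 : ℝ) 1 | K.gamma₁ < K.limitAngle t}) = 0) :
    dimH A ≤ ENNReal.ofReal (kochF₁ K.gamma₁) := by
  have hsplit : Icc (0 : ℝ) 1 = {t ∈ Icc (0 : ℝ) 1 | K.limitAngle t ≤ K.gamma₁} ∪
      {t ∈ Icc (0 : ℝ) 1 | K.gamma₁ < K.limitAngle t} := by
    ext t
    have := le_or_gt (K.limitAngle t) K.gamma₁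
    simp only [mem_union, mem_ofPred_eq]
    tauto
  refine hA.dimH_le.trans ?_
  rw [hsplit, image_union, dimH_union]
  refine max_le (K.dimH_limitMap_le (fun _ h => h.1) K.gamma₁_nonneg K.gamma₁_le_θ_zero
    fun _ h => h.2) ?_
  have h1 := dimH_le_of_hausdorffMeasure_ne_top (d := 1)
    (s := K.toCapData.limitMap '' {t ∈ Icc (0 : ℝ) 1 | K.gamma₁ < K.limitAngle t})
    (by rw [NNReal.coe_one, h]; exact ENNReal.zero_ne_top)
  refine h1.trans ?_
  rw [ENNReal.coe_one, ENNReal.one_le_ofReal]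
  exact K.one_le_kochF₁ K.gamma₁_nonneg K.gamma₁_le_θ_zero

variable (K)

/-- The construction on the base from `0` to `1` with all base angles equal to `γ`. -/
noncomputable def const {γ : ℝ} (h0 : 0 ≤ γ) (h1 : γ ≤ K.θ 0 0) : KochConstruction where
  p := 0
  q := 1
  p_ne_q := zero_ne_one
  θ := fun _ _ => γ
  θ_nonneg := fun _ _ _ => h0
  θ_zero_lt := h1.trans_lt K.θ_zero_lt
  θ_zero_flat := by
    have := K.tan_le_tan h0 h1 le_rfl
    linarith [K.θ_zero_flat]
  θ_left_le := fun _ _ _ => le_rfl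
  θ_right_le := fun _ _ _ => le_rfl

theorem limitAngle_const {γ : ℝ} (h0 : 0 ≤ γ) (h1 : γ ≤ K.θ 0 0) (t : ℝ) :
    (K.const h0 h1).limitAngle t = γ :=
  tendsto_const_nhds.limUnder_eq

theorem gamma₂_const {γ : ℝ} (h0 : 0 ≤ γ) (h1 : γ ≤ K.θ 0 0) :
    (K.const h0 h1).gamma₂ = γ := by
  have h : (K.const h0 h1).limitAngle = fun _ => γ := funext fun t => K.limitAngle_const h0 h1 t
  rw [gamma₂, h, (nonempty_Icc.2 zero_le_one).image_const, csSup_singleton]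

theorem gamma₁_const {γ : ℝ} (h0 : 0 ≤ γ) (h1 : γ ≤ K.θ 0 0) :
    (K.const h0 h1).gamma₁ = γ := by
  refine le_antisymm ((K.const h0 h1).gamma₁_le_θ_zero) ?_
  refine le_csSup (K.const h0 h1).bddAbove_gamma₁ ?_
  have h : (K.const h0 h1).angleGe γ = Icc 0 1 :=
    Subset.antisymm (fun _ h => h.1) fun t ht => ⟨ht, (K.limitAngle_const h0 h1 t).ge⟩
  rw [mem_ofPred_eq, h]
  exact hausdorffMeasure_base_pos _

theorem limitSet_const {γ : ℝ} (h0 : 0 ≤ γ) (h1 : γ ≤ K.θ 0 0) :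
    (K.const h0 h1).toCapData.limitSet = GammaSet (kochF γ) := by
  have : kochF γ = Real.tan γ / 2 := by unfold kochF; ring
  rw [GammaSet, this]
  rfl

theorem dimH_GammaSet {γ : ℝ} (h0 : 0 ≤ γ) (h1 : γ ≤ K.θ 0 0) :
    dimH (GammaSet (kochF γ)) = ENNReal.ofReal (kochF₁ γ) := by
  have hA : (K.const h0 h1).IsKochTypeSet (GammaSet (kochF γ)) :=
    Or.inl (K.limitSet_const h0 h1).symm
  refine le_antisymm ?_ ?_
  · simpa only [gamma₂_const] using hA.dimH_le_kochF₁_gamma₂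
  · simpa only [gamma₁_const] using hA.kochF₁_gamma₁_le_dimH

end KochConstruction

theorem theorem14 (K : KochConstruction) (A : Set ℂ) (hA : K.IsKochTypeSet A) :
    dimH (GammaSet (kochF K.gamma₁)) = ENNReal.ofReal (kochF₁ K.gamma₁) ∧
    ENNReal.ofReal (kochF₁ K.gamma₁) ≤ dimH A ∧
    dimH A ≤ ENNReal.ofReal (kochF₁ K.gamma₂) ∧
    ENNReal.ofReal (kochF₁ K.gamma₂) = dimH (GammaSet (kochF K.gamma₂)) ∧
    ((K.NullToNull ∨
        μH[1] (K.toCapData.limitMap '' K.angleGe K.gamma₁) = 0) →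
      dimH A = ENNReal.ofReal (kochF₁ K.gamma₁)) := by
  refine ⟨K.dimH_GammaSet K.gamma₁_nonneg K.gamma₁_le_θ_zero, hA.kochF₁_gamma₁_le_dimH,
    hA.dimH_le_kochF₁_gamma₂, (K.dimH_GammaSet K.gamma₂_nonneg K.gamma₂_le_θ_zero).symm,
    fun h => le_antisymm (hA.dimH_le_kochF₁_gamma₁ ?_) hA.kochF₁_gamma₁_le_dimH⟩
  rcases h with h | h
  · exact h _ (fun _ ht => ht.1) K.hausdorffMeasure_angle_gt_gamma₁
  · have hsub : {t ∈ Icc (0 : ℝ) 1 | K.gamma₁ < K.limitAngle t} ⊆ K.angleGe K.gamma₁ :=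
      fun _ ht => ⟨ht.1, ht.2.le⟩
    exact measure_mono_null (image_mono hsub) h
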